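/- Let $\mathbb{S}^n=\{x=(x_0,\dots,x_n)\in\mathbb{R}^{n+1}: |x|=1\}$ be the round unit sphere and, for $0<r<\pi/2$, let $\mathbb{B}^n(r)=\{x\in\mathbb{S}^n : x_0\ge\cos r\}$ be the geodesic ball with center $(1,0,\dots,0)$ and radius $r$, with boundary $\partial\mathbb{B}^n(r)=\{x\in\mathbb{S}^n: x_0=\cos r\}$. Let $(\Sigma^k,g)$, $k\ge 1$, be a compact smooth Riemannian manifold of dimension $k$ with (possibly empty) boundary, and let $\nu$ be the outward pointing unit $g$-normal vector of $\partial\Sigma$. Let $\Phi:(\Sigma,g)\to\mathbb{B}^n(r)$ be a smooth isometric immersion such that $\Phi(\partial\Sigma)\subset\partial\mathbb{B}^n(r)$. We say that $\Phi$ is minimal if its mean curvature vector in $\mathbb{S}^n$ (the $g$-trace of its second fundamental form) vanishes identically on $\Sigma$, and free boundary if $\Sigma$ meets $\partial\mathbb{B}^n(r)$ orthogonally, that is, if $d\Phi(\nu)$ is orthogonal to $T\partial\mathbb{B}^n(r)$ at every point of $\partial\Sigma$. Let $\Delta_g=\operatorname{tr}_g\nabla d$ be the Laplace-Beltrami operator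 of $g$. Then $\Phi$ is minimal and free boundary if, and only if, the coordinate functions $\phi_i=x_i\circ\Phi$ satisfy \begin{align*} \Delta_g\,\phi_i+k\phi_i&=0\quad\text{in }\Sigma,\ i=0,1,\dots,n,\\ \frac{\partial\phi_0}{\partial\nu}+(\tan r)\,\phi_0&=0\quad\text{on }\partial\Sigma,\\ \frac{\partial\phi_i}{\partial\nu}-(\cot r)\,\phi_i&=0\quad\text{on }\partial\Sigma,\ i=1,\dots,n. \end{align*} -/

import Mathlib

open scoped Manifold ContDiff

noncomputable section

namespace FreeBoundary

/-- The Euclidean space `ℝᵐ`. -/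
abbrev Euc (m : ℕ) : Type := EuclideanSpace ℝ (Fin m)

/-- A smooth Riemannian metric on a smooth manifold with boundary `M` of dimension `k`. -/
abbrev RiemMetric (k : ℕ) [NeZero k] (M : Type*) [TopologicalSpace M]
    [ChartedSpace (EuclideanHalfSpace k) M] [IsManifold (𝓡∂ k) ∞ M] : Type _ :=
  Bundle.ContMDiffRiemannianMetric (𝓡∂ k) ∞ (Euc k) (fun p : M => TangentSpace (𝓡∂ k) p)

/-! ### Geodesic balls of the round sphere -/

/-- The geodesic ball `𝔹ⁿ(r) = {x ∈ 𝕊ⁿ : x₀ ≥ cos r}` of the unit sphere `𝕊ⁿ ⊆ ℝⁿ⁺¹`, of centre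
`(1, 0, …, 0)` and radius `r`. -/
def capBall (n : ℕ) (r : ℝ) : Set (Euc (n + 1)) :=
  {x | ‖x‖ = 1 ∧ Real.cos r ≤ x 0}

/-- The boundary `∂𝔹ⁿ(r) = {x ∈ 𝕊ⁿ : x₀ = cos r}` of the geodesic ball. -/
def capSphere (n : ℕ) (r : ℝ) : Set (Euc (n + 1)) :=
  {x | ‖x‖ = 1 ∧ x 0 = Real.cos r}

/-- The tangent space `T_x 𝕊ⁿ`, as a subspace of `ℝⁿ⁺¹`. -/
def sphereTangent {n : ℕ} (x : Euc (n + 1)) : Submodule ℝ (Euc (n + 1)) :=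
  (Submodule.span ℝ {x})ᗮ

/-- The tangent space `T_x ∂𝔹ⁿ(r)` at a point `x` of `∂𝔹ⁿ(r)`, as a subspace of `ℝⁿ⁺¹`: the vectors
tangent to `𝕊ⁿ` whose `0`-th coordinate vanishes. -/
def capSphereTangent {n : ℕ} (x : Euc (n + 1)) : Submodule ℝ (Euc (n + 1)) :=
  sphereTangent x ⊓ (Submodule.span ℝ {EuclideanSpace.single 0 (1 : ℝ)})ᗮ

section Manifold

variable {k : ℕ} [NeZero k] {M : Type*} [TopologicalSpace M]
  [ChartedSpace (EuclideanHalfSpace k) M]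

/-! ### Calculus in a chart

All derivatives of coordinate expressions are taken within the half space `Set.range (𝓡∂ k)`, so
that they are the (one-sided) derivatives at boundary points. -/

/-- The partial derivative `∂ᵢu` of a function `u` on the half space. -/
def pderiv {F : Type*} [NormedAddCommGroup F] [NormedSpace ℝ F] (i : Fin k)
    (u : Euc k → F) (y : Euc k) : F :=
  fderivWithin ℝ u (Set.range (𝓡∂ k)) y (EuclideanSpace.single i (1 : ℝ))

/-- The expression of a function on `M` in the chart at `p`. -/
def inChart {F : Type*} (p : M) (f : M → F) : Euc k → F :=
  f ∘ (extChartAt (𝓡∂ k) p).symm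

/-- The `i`-th coordinate vector field of the chart at `p`, at the point of coordinates `y`. -/
def coordVector (p : M) (i : Fin k) (y : Euc k) :
    TangentSpace (𝓡∂ k) ((extChartAt (𝓡∂ k) p).symm y) :=
  mfderivWithin 𝓘(ℝ, Euc k) (𝓡∂ k) (extChartAt (𝓡∂ k) p).symm (Set.range (𝓡∂ k)) y
    (EuclideanSpace.single i (1 : ℝ) : Euc k)

/-- The differential `dΦ_p : T_pM → ℝᵐ` of a map `Φ : M → ℝᵐ`. -/
def differential {m : ℕ} (Φ : M → Euc m) (p : M) : TangentSpace (𝓡∂ k) p →L[ℝ] Euc m :=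
  mfderiv (𝓡∂ k) 𝓘(ℝ, Euc m) Φ p

/-- The derivative `df_p(v)` of a function `f : M → ℝ` in the direction `v ∈ T_pM`. -/
def dirDeriv (f : M → ℝ) (p : M) (v : TangentSpace (𝓡∂ k) p) : ℝ :=
  mfderiv (𝓡∂ k) 𝓘(ℝ, ℝ) f p v

variable [IsManifold (𝓡∂ k) ∞ M]

/-- The matrix `(g_ij)` of the metric in the chart at `p`, at the point of coordinates `y`. -/
def gram (g : RiemMetric k M) (p : M) (y : Euc k) : Matrix (Fin k) (Fin k) ℝ :=
  Matrix.of fun i j => g.inner _ (coordVector p i y) (coordVector p j y)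

/-- The inverse matrix `(g^ij)`. -/
def gramInv (g : RiemMetric k M) (p : M) (y : Euc k) : Matrix (Fin k) (Fin k) ℝ :=
  (gram g p y)⁻¹

/-- The Christoffel symbols `Γˡ_ij` of the Levi-Civita connection of `g` in the chart at `p`. -/
def christoffel (g : RiemMetric k M) (p : M) (l i j : Fin k) (y : Euc k) : ℝ :=
  (1 / 2) * ∑ m, gramInv g p y l m *
    (pderiv i (fun z => gram g p z m j) y + pderiv j (fun z => gram g p z i m) y
      - pderiv m (fun z => gram g p z i j) y)

/-- The components `∂ᵢ∂ⱼf - Γˡ_ij ∂ₗf` of the Hessian `∇df`, at `p` and in the chart at `p`. -/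
def hessian (g : RiemMetric k M) (f : M → ℝ) (p : M) (i j : Fin k) : ℝ :=
  let x : Euc k := extChartAt (𝓡∂ k) p p
  pderiv i (pderiv j (inChart p f)) x
    - ∑ l, christoffel g p l i j x * pderiv l (inChart p f) x

/-- The Laplace-Beltrami operator `Δ_g f = tr_g ∇df = g^ij (∂ᵢ∂ⱼf - Γˡ_ij ∂ₗf)`. -/
def laplacian (g : RiemMetric k M) (f : M → ℝ) (p : M) : ℝ :=
  ∑ i, ∑ j, gramInv g p (extChartAt (𝓡∂ k) p p) i j * hessian g f p i j

/-! ### The boundary -/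

/-- The function `v ↦ d(x⁰)_p(v)` on `T_pM`, where `x⁰ ≥ 0` is the coordinate of the chart at `p`
that defines the boundary. At a boundary point its kernel is `T_p∂M`, and the vectors on which it is
negative are the ones that point outward. -/
def inwardPart (p : M) : TangentSpace (𝓡∂ k) p →L[ℝ] ℝ :=
  (EuclideanSpace.proj (0 : Fin k) : Euc k →L[ℝ] ℝ).comp
    (differential (extChartAt (𝓡∂ k) p) p)

/-- `v ∈ T_pM` (at a boundary point `p`) is the outward pointing `g`-unit normal of `∂M`: it has
`g`-length one, is `g`-orthogonal to `T_p∂M`, and points outward. -/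
structure IsOutwardUnitNormal (g : RiemMetric k M) (p : M) (v : TangentSpace (𝓡∂ k) p) : Prop where
  unit : g.inner p v v = 1
  orthogonal : ∀ w : TangentSpace (𝓡∂ k) p, inwardPart p w = 0 → g.inner p v w = 0
  outward : inwardPart p v < 0

theorem exists_inwardPart_ne_zero (p : M) : ∃ v : TangentSpace (𝓡∂ k) p, inwardPart p v ≠ 0 := by
  have hinv := isInvertible_mfderiv_extChartAt (I := 𝓡∂ k) (x := p) (mem_extChartAt_source p)
  obtain ⟨e, he⟩ := hinv
  refine ⟨e.symm (EuclideanSpace.single 0 (1 : ℝ) : Euc k), ?_⟩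
  have : differential (extChartAt (𝓡∂ k) p) p
      (e.symm (EuclideanSpace.single 0 (1 : ℝ) : Euc k))
      = (EuclideanSpace.single 0 (1 : ℝ) : Euc k) := by
    unfold differential
    rw [← he]; exact e.apply_symm_apply _
  unfold inwardPart
  rw [ContinuousLinearMap.comp_apply, this]
  simp

theorem existsUnique_isOutwardUnitNormal (g : RiemMetric k M) (p : M) :
    ∃! v : TangentSpace (𝓡∂ k) p, IsOutwardUnitNormal g p v := by
  have : FiniteDimensional ℝ (TangentSpace (𝓡∂ k) p) :=
    inferInstanceAs (FiniteDimensional ℝ (Euc k))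
  let B : TangentSpace (𝓡∂ k) p →ₗ[ℝ] Module.Dual ℝ (TangentSpace (𝓡∂ k) p) :=
    { toFun := fun v => (g.inner p v).toLinearMap
      map_add' := fun v w => by ext x; simp
      map_smul' := fun c w => by ext x; simp }
  have hB : Function.Injective B := by
    rw [← LinearMap.ker_eq_bot, LinearMap.ker_eq_bot']
    intro v hv
    by_contra hne
    have h1 : g.inner p v v = 0 := LinearMap.congr_fun hv v
    exact (g.pos p v hne).ne' h1
  have hS : Function.Surjective B :=
    (LinearMap.injective_iff_surjective_of_finrank_eq_finrank
      Subspace.dual_finrank_eq.symm).1 hB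
  obtain ⟨u, hu⟩ := hS (inwardPart p).toLinearMap
  have hu' : ∀ w, g.inner p u w = inwardPart p w := fun w => LinearMap.congr_fun hu w
  have hu0 : u ≠ 0 := by
    rintro rfl
    obtain ⟨v, hv⟩ := exists_inwardPart_ne_zero (k := k) p
    exact hv (by rw [← hu' v]; simp)
  have hc : 0 < inwardPart p u := by rw [← hu' u]; exact g.pos p u hu0
  set s : ℝ := Real.sqrt (inwardPart p u) with hs
  have hs0 : 0 < s := Real.sqrt_pos.2 hc
  have hss : s * s = inwardPart p u := Real.mul_self_sqrt hc.le
  have hν : IsOutwardUnitNormal g p ((-s⁻¹) • u) := by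
    refine ⟨?_, fun w hw => ?_, ?_⟩
    · simp only [map_smul, _root_.smul_apply, smul_eq_mul, hu', ← hss]
      field_simp
    · simp only [map_smul, _root_.smul_apply, smul_eq_mul, hu', hw, mul_zero]
    · simp only [map_smul, smul_eq_mul, ← hss]
      have : -s⁻¹ * (s * s) = -s := by field_simp
      rw [this]; linarith
  refine ⟨_, hν, fun v hv => ?_⟩
  set n := (-s⁻¹) • u
  have hn : inwardPart p n < 0 := hν.outward
  have hv0 : inwardPart p v < 0 := hv.outward
  set a : ℝ := inwardPart p v / inwardPart p n with ha
  have ha0 : 0 < a := div_pos_of_neg_of_neg hv0 hn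
  have hw : inwardPart p (v - a • n) = 0 := by
    simp only [map_sub, map_smul, smul_eq_mul, ha]
    field_simp [hn.ne]
    ring
  have h1 := hv.orthogonal _ hw
  have h2 := hν.orthogonal _ hw
  have h3 : v - a • n = 0 := by
    by_contra hne
    have h4 := g.pos p _ hne
    rw [map_sub (g.inner p), map_smul (g.inner p), _root_.sub_apply,
      _root_.smul_apply, h1, h2] at h4
    simp at h4
  have h5 : v = a • n := sub_eq_zero.1 h3
  have h6 := hv.unit
  rw [h5] at h6
  simp only [map_smul, _root_.smul_apply, smul_eq_mul, hν.unit] at h6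
  have h7 : a = 1 := by nlinarith
  rw [h5, h7, one_smul]

/-- The outward pointing unit normal `ν` of `∂M` at a boundary point `p`. -/
def outwardUnitNormal (g : RiemMetric k M) (p : M) : TangentSpace (𝓡∂ k) p :=
  (existsUnique_isOutwardUnitNormal g p).choose

theorem isOutwardUnitNormal_outwardUnitNormal (g : RiemMetric k M) (p : M) :
    IsOutwardUnitNormal g p (outwardUnitNormal g p) :=
  (existsUnique_isOutwardUnitNormal g p).choose_spec.1

/-! ### Isometric immersions into the sphere -/

/-- `Φ : (M, g) → 𝔹ⁿ(r)` is a (smooth, up to the boundary) isometric immersion. It is automatically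
an immersion, as `g` is positive definite. -/
structure IsIsometricImmersion {n : ℕ} (g : RiemMetric k M) (r : ℝ) (Φ : M → Euc (n + 1)) : Prop where
  smooth : ContMDiff (𝓡∂ k) 𝓘(ℝ, Euc (n + 1)) ∞ Φ
  mapsTo : ∀ p, Φ p ∈ capBall n r
  isometric : ∀ (p : M) (v w : TangentSpace (𝓡∂ k) p),
    inner ℝ (differential Φ p v) (differential Φ p w) = g.inner p v w

/-- The normal space at `p` of an immersion `Φ` into `𝕊ⁿ`: the orthogonal complement of `dΦ(T_pM)`
in `T_{Φ(p)}𝕊ⁿ`. -/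
def normalSpace (k : ℕ) [NeZero k] [ChartedSpace (EuclideanHalfSpace k) M] {n : ℕ}
    (Φ : M → Euc (n + 1)) (p : M) : Submodule ℝ (Euc (n + 1)) :=
  sphereTangent (Φ p) ⊓ (LinearMap.range (differential (k := k) Φ p).toLinearMap)ᗮ

/-- The components `II(∂ᵢ, ∂ⱼ)`, at `p` and in the chart at `p`, of the second fundamental form of an
immersion `Φ` into `𝕊ⁿ`: the component normal to `Φ` of the derivative of `∂ⱼΦ` in the direction
`∂ᵢ` for the Levi-Civita connection of `𝕊ⁿ`, which is the orthogonal projection to `T𝕊ⁿ` of the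
derivative in `ℝⁿ⁺¹`. -/
def secondFundamentalForm {n : ℕ} (Φ : M → Euc (n + 1)) (p : M) (i j : Fin k) : Euc (n + 1) :=
  (normalSpace k Φ p).starProjection ((sphereTangent (Φ p)).starProjection
    (pderiv i (pderiv j (inChart p Φ)) (extChartAt (𝓡∂ k) p p)))

/-- The mean curvature vector `H = tr_g II` of an immersion `Φ : (M, g) → 𝕊ⁿ`. -/
def meanCurvature {n : ℕ} (g : RiemMetric k M) (Φ : M → Euc (n + 1)) (p : M) : Euc (n + 1) :=
  ∑ i, ∑ j, gramInv g p (extChartAt (𝓡∂ k) p p) i j • secondFundamentalForm Φ p i j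

/-- `Φ : (M, g) → 𝕊ⁿ` is minimal: its mean curvature vector vanishes. -/
def IsMinimal {n : ℕ} (g : RiemMetric k M) (Φ : M → Euc (n + 1)) : Prop :=
  ∀ p, meanCurvature g Φ p = 0

/-- `Φ : (M, g) → 𝔹ⁿ(r)` with `Φ(∂M) ⊆ ∂𝔹ⁿ(r)` is free boundary: `M` meets `∂𝔹ⁿ(r)` orthogonally, that
is, the conormal `dΦ(ν)` of `∂M` is orthogonal to `∂𝔹ⁿ(r)` at every boundary point. -/
def IsFreeBoundary {n : ℕ} (g : RiemMetric k M) (Φ : M → Euc (n + 1)) : Prop :=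
  ∀ p ∈ (𝓡∂ k).boundary M, ∀ w ∈ capSphereTangent (Φ p),
    inner ℝ (differential Φ p (outwardUnitNormal g p)) w = 0

end Manifold

end FreeBoundary

end

open FreeBoundary

/-! In the chart at `p`, subtracting the Christoffel terms from `∂ᵢ∂ⱼΦ` removes exactly its
component in `dΦ(T_pM)`, since `g` is the induced metric. Differentiating `⟨Φ, ∂ⱼΦ⟩ = 0` shows that
its component along `Φ` is `-g_ij Φ`. Hence `II_ij = (∇dΦ)_ij + g_ij Φ`
(`secondFundamentalForm_eq`), and the trace `H = ΔΦ + kΦ` (`meanCurvature_coordinate`) turns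
minimality into the equations in the interior.

On the boundary, `N = dΦ(ν)` is a unit vector orthogonal to `x = Φ(p)`. It is orthogonal to
`T∂𝔹ⁿ(r)` iff it lies in the span of `x` and the centre `e₀`, which leaves `N = ±(cos r · x - e₀) /
sin r`. The sign is `+` because `φ₀` attains its minimum `cos r` on the boundary. In coordinates
this is the pair of Robin conditions (`forall_capSphereTangent_iff`). -/

noncomputable section

namespace FreeBoundary

open Set Filter Topology

/-! ### Partial derivatives within the half space. -/

section Calculus

variable {k : ℕ} [NeZero k] {F : Type*} [NormedAddCommGroup F] [NormedSpace ℝ F]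

theorem pderiv_congr_of_eventuallyEq {i : Fin k} {u v : Euc k → F} {y : Euc k}
    (h : u =ᶠ[𝓝[range (𝓡∂ k)] y] v) (hy : y ∈ range (𝓡∂ k)) : pderiv i u y = pderiv i v y := by
  unfold pderiv
  rw [h.fderivWithin_eq_of_mem hy]

theorem pderiv_clm_comp {G : Type*} [NormedAddCommGroup G] [NormedSpace ℝ G] (L : F →L[ℝ] G)
    (i : Fin k) {u : Euc k → F} {y : Euc k} (hy : y ∈ range (𝓡∂ k))
    (hu : DifferentiableWithinAt ℝ u (range (𝓡∂ k)) y) :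
    pderiv i (fun z => L (u z)) y = L (pderiv i u y) := by
  have h := (L.hasFDerivAt.comp_hasFDerivWithinAt y hu.hasFDerivWithinAt).fderivWithin
    ((𝓡∂ k).uniqueDiffOn y hy)
  unfold pderiv
  change fderivWithin ℝ (L ∘ u) _ _ _ = _
  rw [h]
  rfl

theorem pderiv_inner {m : ℕ} (i : Fin k) {u v : Euc k → Euc m} {y : Euc k}
    (hy : y ∈ range (𝓡∂ k))
    (hu : DifferentiableWithinAt ℝ u (range (𝓡∂ k)) y)
    (hv : DifferentiableWithinAt ℝ v (range (𝓡∂ k)) y) :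
    pderiv i (fun z => inner ℝ (u z) (v z)) y
      = inner ℝ (u y) (pderiv i v y) + inner ℝ (pderiv i u y) (v y) := by
  unfold pderiv
  rw [(hu.hasFDerivWithinAt.inner ℝ hv.hasFDerivWithinAt).fderivWithin
    ((𝓡∂ k).uniqueDiffOn y hy)]
  simp [fderivInnerCLM_apply]

theorem contDiffWithinAt_pderiv (i : Fin k) {u : Euc k → F} {y : Euc k}
    (hy : y ∈ range (𝓡∂ k)) (hu : ContDiffWithinAt ℝ ∞ u (range (𝓡∂ k)) y) :
    ContDiffWithinAt ℝ ∞ (pderiv i u) (range (𝓡∂ k)) y :=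
  (hu.fderivWithin_right (𝓡∂ k).uniqueDiffOn (by simp) hy).clm_apply contDiffWithinAt_const

/-- Schwarz's theorem survives at boundary points because the half space lies in the closure of its
interior. -/
theorem pderiv_comm (i j : Fin k) {u : Euc k → F} {y : Euc k}
    (hy : y ∈ range (𝓡∂ k)) (hu : ContDiffWithinAt ℝ ∞ u (range (𝓡∂ k)) y) :
    pderiv i (pderiv j u) y = pderiv j (pderiv i u) y := by
  have hs := (𝓡∂ k).uniqueDiffOn
  have hd : DifferentiableWithinAt ℝ (fderivWithin ℝ u (range (𝓡∂ k))) (range (𝓡∂ k)) y :=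
    (hu.fderivWithin_right (m := ∞) hs (by simp) hy).differentiableWithinAt (by simp)
  have key : ∀ a b : Fin k, pderiv a (pderiv b u) y
      = fderivWithin ℝ (fderivWithin ℝ u (range (𝓡∂ k))) (range (𝓡∂ k)) y
        (EuclideanSpace.single a 1) (EuclideanSpace.single b 1) := fun a b =>
    pderiv_clm_comp (ContinuousLinearMap.apply ℝ F (EuclideanSpace.single b (1 : ℝ))) a hy hd
  rw [key, key]
  exact hu.isSymmSndFDerivWithinAt
    (by simpa [minSmoothness_of_isRCLikeNormedField] using! WithTop.coe_le_coe.2 (le_top (a := (2 : ℕ∞)))) hs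
    ((𝓡∂ k).range_subset_closure_interior hy) hy _ _

end Calculus

/-! ### The metric and the differential in a chart. -/

section Manifold

variable {k : ℕ} [NeZero k] {M : Type*} [TopologicalSpace M]
  [ChartedSpace (EuclideanHalfSpace k) M] [IsManifold (𝓡∂ k) ∞ M]

theorem contDiffWithinAt_inChart {m : ℕ} {Φ : M → Euc m}
    (hΦ : ContMDiff (𝓡∂ k) 𝓘(ℝ, Euc m) ∞ Φ) (p : M) {y : Euc k}
    (hy : y ∈ (extChartAt (𝓡∂ k) p).target) :
    ContDiffWithinAt ℝ ∞ (inChart p Φ) (range (𝓡∂ k)) y := by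
  rw [← contMDiffWithinAt_iff_contDiffWithinAt]
  exact hΦ.contMDiffAt.comp_contMDiffWithinAt y
    (contMDiffWithinAt_extChartAt_symm_range p hy)

theorem differential_coordVector {m : ℕ} {Φ : M → Euc m}
    (hΦ : ContMDiff (𝓡∂ k) 𝓘(ℝ, Euc m) ∞ Φ) (p : M) (i : Fin k) {y : Euc k}
    (hy : y ∈ (extChartAt (𝓡∂ k) p).target) :
    differential Φ _ (coordVector p i y) = pderiv i (inChart p Φ) y := by
  have h := mfderiv_comp_mfderivWithin (I := 𝓘(ℝ, Euc k)) y
    (hΦ.mdifferentiableAt (by simp) (x := (extChartAt (𝓡∂ k) p).symm y))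
    (mdifferentiableWithinAt_extChartAt_symm hy)
    ((𝓡∂ k).uniqueDiffOn.uniqueMDiffOn y (extChartAt_target_subset_range p hy))
  unfold differential coordVector pderiv inChart
  rw [← mfderivWithin_eq_fderivWithin, h]
  rfl

theorem gram_apply {n : ℕ} {g : RiemMetric k M} {r : ℝ} {Φ : M → Euc (n + 1)}
    (hΦ : IsIsometricImmersion g r Φ) (p : M) (i j : Fin k) {y : Euc k}
    (hy : y ∈ (extChartAt (𝓡∂ k) p).target) :
    gram g p y i j = inner ℝ (pderiv i (inChart p Φ) y) (pderiv j (inChart p Φ) y) := by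
  rw [← differential_coordVector hΦ.smooth p i hy, ← differential_coordVector hΦ.smooth p j hy,
    hΦ.isometric]
  rfl

omit [IsManifold (𝓡∂ k) ∞ M] in
theorem mfderiv_eq_fderivWithin_inChart {F : Type*} [NormedAddCommGroup F] [NormedSpace ℝ F]
    {f : M → F} {p : M} (hf : MDifferentiableAt (𝓡∂ k) 𝓘(ℝ, F) f p) (v : Euc k) :
    (mfderiv (𝓡∂ k) 𝓘(ℝ, F) f p : Euc k →L[ℝ] F) v
      = fderivWithin ℝ (inChart p f) (range (𝓡∂ k)) (extChartAt (𝓡∂ k) p p) v := by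
  rw [hf.mfderiv]
  rfl

/-- The chart at `p`, read in itself, is the identity near the image of `p`. -/
theorem inwardPart_eq (p : M) (v : TangentSpace (𝓡∂ k) p) : inwardPart p v = @WithLp.ofLp 2 (Fin k → ℝ) v 0 := by
  have hx := mem_extChartAt_target (I := 𝓡∂ k) p
  have hr := extChartAt_target_subset_range (I := 𝓡∂ k) p hx
  have h : inChart p (extChartAt (𝓡∂ k) p) =ᶠ[𝓝[range (𝓡∂ k)] (extChartAt (𝓡∂ k) p p)] id := by
    filter_upwards [extChartAt_target_mem_nhdsWithin (I := 𝓡∂ k) p] with y hy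
    exact (extChartAt (𝓡∂ k) p).right_inv hy
  have hd : differential (extChartAt (𝓡∂ k) p) p v = (v : Euc k) := by
    have := mfderiv_eq_fderivWithin_inChart (p := p)
      (mdifferentiableAt_extChartAt (I := 𝓡∂ k) (mem_chart_source _ p)) v
    rw [h.fderivWithin_eq_of_mem hr, fderivWithin_id ((𝓡∂ k).uniqueDiffOn _ hr)] at this
    exact this
  unfold inwardPart
  rw [ContinuousLinearMap.comp_apply, hd]
  rfl

theorem fderivWithin_eq_sum_pderiv {F : Type*} [NormedAddCommGroup F] [NormedSpace ℝ F]
    (u : Euc k → F) (y v : Euc k) :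
    fderivWithin ℝ u (range (𝓡∂ k)) y v = ∑ i, v i • pderiv i u y := by
  conv_lhs => rw [← (EuclideanSpace.basisFun (Fin k) ℝ).sum_repr v]
  simp [pderiv]

/-- The quadratic form at `c` is `|dΦ(v)|² = g(v, v)`, where `v` has components `c`. This supplies
the invertibility and symmetry of the Gram matrix. -/
theorem posDef_gram {n : ℕ} {g : RiemMetric k M} {r : ℝ} {Φ : M → Euc (n + 1)}
    (hΦ : IsIsometricImmersion g r Φ) (p : M) :
    (gram g p (extChartAt (𝓡∂ k) p p)).PosDef := by
  have hx := mem_extChartAt_target (I := 𝓡∂ k) p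
  refine Matrix.PosDef.of_dotProduct_mulVec_pos ?_ fun c hc => ?_
  · refine Matrix.IsHermitian.ext fun i j => ?_
    rw [gram_apply hΦ p _ _ hx, gram_apply hΦ p _ _ hx,
      real_inner_comm, star_trivial]
  · let v : TangentSpace (𝓡∂ k) p := (WithLp.toLp 2 c : Euc k)
    have hv : v ≠ 0 := fun h => hc (congrArg (WithLp.ofLp : Euc k → Fin k → ℝ) h)
    have h1 : 0 < g.inner p v v := g.pos p v hv
    have h2 : differential Φ p v = ∑ i, c i • pderiv i (inChart p Φ) (extChartAt (𝓡∂ k) p p) := by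
      rw [← fderivWithin_eq_sum_pderiv _ _ v]
      exact mfderiv_eq_fderivWithin_inChart (hΦ.smooth.mdifferentiableAt (by simp)) v
    rw [← hΦ.isometric, h2] at h1
    refine h1.trans_eq (Eq.symm ?_)
    simp only [dotProduct, Matrix.mulVec, gram_apply hΦ p _ _ hx, sum_inner, inner_sum,
      real_inner_smul_left, real_inner_smul_right, Finset.mul_sum, star_trivial]
    refine Finset.sum_congr rfl fun i _ => Finset.sum_congr rfl fun j _ => ?_
    rw [real_inner_comm]
    ring

end Manifold

/-! ### The Hessian of `Φ`, the second fundamental form and the mean curvature. -/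

section Hessian

variable {k : ℕ} [NeZero k] {M : Type*} [TopologicalSpace M]
  [ChartedSpace (EuclideanHalfSpace k) M] [IsManifold (𝓡∂ k) ∞ M]
  {n : ℕ} {g : RiemMetric k M} {r : ℝ} {Φ : M → Euc (n + 1)}

omit [IsManifold (𝓡∂ k) ∞ M] in
theorem inChart_self {F : Type*} (f : M → F) (p : M) :
    inChart p f (extChartAt (𝓡∂ k) p p) = f p :=
  congrArg f (extChartAt_to_inv (I := 𝓡∂ k) p)

/-- The Hessian `∇dΦ` of a vector valued map, in the chart at `p`. -/
def vectorHessian (g : RiemMetric k M) (Φ : M → Euc (n + 1)) (p : M) (i j : Fin k) :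
    Euc (n + 1) :=
  pderiv i (pderiv j (inChart p Φ)) (extChartAt (𝓡∂ k) p p)
    - ∑ l, christoffel g p l i j (extChartAt (𝓡∂ k) p p) •
      pderiv l (inChart p Φ) (extChartAt (𝓡∂ k) p p)

theorem hessian_coordinate (hΦ : ContMDiff (𝓡∂ k) 𝓘(ℝ, Euc (n + 1)) ∞ Φ) (p : M) (i j : Fin k)
    (a : Fin (n + 1)) :
    hessian g (fun q => Φ q a) p i j = vectorHessian g Φ p i j a := by
  have hx := mem_extChartAt_target (I := 𝓡∂ k) p
  have hr := extChartAt_target_subset_range (I := 𝓡∂ k) p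
  have h1 : ∀ l : Fin k, ∀ y ∈ (extChartAt (𝓡∂ k) p).target,
      pderiv l (inChart p (fun q => Φ q a)) y = pderiv l (inChart p Φ) y a := fun l y hy =>
    pderiv_clm_comp (EuclideanSpace.proj a : Euc (n + 1) →L[ℝ] ℝ) l (hr hy)
      ((contDiffWithinAt_inChart hΦ p hy).differentiableWithinAt (by simp))
  have h2 : pderiv i (pderiv j (inChart p (fun q => Φ q a))) (extChartAt (𝓡∂ k) p p)
      = pderiv i (pderiv j (inChart p Φ)) (extChartAt (𝓡∂ k) p p) a := by
    rw [pderiv_congr_of_eventuallyEq (v := fun y => pderiv j (inChart p Φ) y a) _ (hr hx)]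
    · exact pderiv_clm_comp (EuclideanSpace.proj a : Euc (n + 1) →L[ℝ] ℝ) i (hr hx)
        ((contDiffWithinAt_pderiv j (hr hx)
          (contDiffWithinAt_inChart hΦ p hx)).differentiableWithinAt (by simp))
    · filter_upwards [extChartAt_target_mem_nhdsWithin (I := 𝓡∂ k) p] with y hy
      exact h1 j y hy
  simp only [hessian, vectorHessian, h2, h1 _ _ hx]
  simp

theorem pderiv_gram (hΦ : IsIsometricImmersion g r Φ) (p : M) (m i j : Fin k) :
    pderiv m (fun z => gram g p z i j) (extChartAt (𝓡∂ k) p p)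
      = inner ℝ (pderiv m (pderiv i (inChart p Φ)) (extChartAt (𝓡∂ k) p p))
          (pderiv j (inChart p Φ) (extChartAt (𝓡∂ k) p p))
        + inner ℝ (pderiv m (pderiv j (inChart p Φ)) (extChartAt (𝓡∂ k) p p))
          (pderiv i (inChart p Φ) (extChartAt (𝓡∂ k) p p)) := by
  have hx := mem_extChartAt_target (I := 𝓡∂ k) p
  have hr := extChartAt_target_subset_range (I := 𝓡∂ k) p hx
  have hd : ∀ l : Fin k, DifferentiableWithinAt ℝ (pderiv l (inChart p Φ)) (range (𝓡∂ k))
      (extChartAt (𝓡∂ k) p p) := fun l =>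
    (contDiffWithinAt_pderiv l hr
      (contDiffWithinAt_inChart hΦ.smooth p hx)).differentiableWithinAt (by simp)
  rw [pderiv_congr_of_eventuallyEq (v := fun y => inner ℝ (pderiv i (inChart p Φ) y)
    (pderiv j (inChart p Φ) y)) _ hr, pderiv_inner m hr (hd i) (hd j), real_inner_comm, add_comm]
  filter_upwards [extChartAt_target_mem_nhdsWithin (I := 𝓡∂ k) p] with y hy
  exact gram_apply hΦ p i j hy

/-- Expanding each `∂g` by the product rule gives six terms; since partial derivatives commute, four
cancel and the other two coincide. -/
theorem christoffel_eq (hΦ : IsIsometricImmersion g r Φ) (p : M) (l i j : Fin k) :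
    christoffel g p l i j (extChartAt (𝓡∂ k) p p)
      = ∑ m, gramInv g p (extChartAt (𝓡∂ k) p p) l m *
        inner ℝ (pderiv i (pderiv j (inChart p Φ)) (extChartAt (𝓡∂ k) p p))
          (pderiv m (inChart p Φ) (extChartAt (𝓡∂ k) p p)) := by
  have hx := mem_extChartAt_target (I := 𝓡∂ k) p
  have hr := extChartAt_target_subset_range (I := 𝓡∂ k) p hx
  have hc : ∀ a b, _ := fun a b => pderiv_comm a b hr (contDiffWithinAt_inChart hΦ.smooth p hx)
  unfold christoffel
  rw [Finset.mul_sum]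
  refine Finset.sum_congr rfl fun m _ => ?_
  rw [pderiv_gram hΦ, pderiv_gram hΦ, pderiv_gram hΦ, hc j i, hc m i, hc m j]
  ring

/-- With `A m = ⟨∂ᵢ∂ⱼΦ, ∂ₘΦ⟩`, `christoffel_eq` reads `Γ = g⁻¹A`. So `gΓ = A`, which says that `Γˡ
∂ₗΦ` is the tangential part of `∂ᵢ∂ⱼΦ`. -/
theorem inner_vectorHessian_pderiv (hΦ : IsIsometricImmersion g r Φ) (p : M) (i j m : Fin k) :
    inner ℝ (pderiv m (inChart p Φ) (extChartAt (𝓡∂ k) p p)) (vectorHessian g Φ p i j) = 0 := by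
  have hx := mem_extChartAt_target (I := 𝓡∂ k) p
  set A : Fin k → ℝ := fun m =>
    inner ℝ (pderiv i (pderiv j (inChart p Φ)) (extChartAt (𝓡∂ k) p p))
      (pderiv m (inChart p Φ) (extChartAt (𝓡∂ k) p p)) with hA
  have hΓ : (fun l => christoffel g p l i j (extChartAt (𝓡∂ k) p p))
      = (gramInv g p (extChartAt (𝓡∂ k) p p)).mulVec A :=
    funext fun l => christoffel_eq hΦ p l i j
  have hdet : IsUnit (gram g p (extChartAt (𝓡∂ k) p p)).det :=
    (Matrix.isUnit_iff_isUnit_det _).1 (posDef_gram hΦ p).isUnit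
  have h : (gram g p (extChartAt (𝓡∂ k) p p)).mulVec
      (fun l => christoffel g p l i j (extChartAt (𝓡∂ k) p p)) = A := by
    rw [hΓ, Matrix.mulVec_mulVec, gramInv, Matrix.mul_nonsing_inv _ hdet, Matrix.one_mulVec]
  have hm := congrFun h m
  simp only [Matrix.mulVec, dotProduct, gram_apply hΦ p _ _ hx, hA] at hm
  simp only [vectorHessian, inner_sub_right, inner_sum, real_inner_smul_right]
  rw [real_inner_comm, ← hm, sub_eq_zero]
  exact Finset.sum_congr rfl fun l _ => mul_comm _ _

theorem inner_inChart_pderiv (hΦ : IsIsometricImmersion g r Φ) (p : M) (j : Fin k) {y : Euc k}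
    (hy : y ∈ (extChartAt (𝓡∂ k) p).target) :
    inner ℝ (inChart p Φ y) (pderiv j (inChart p Φ) y) = 0 := by
  have hr := extChartAt_target_subset_range (I := 𝓡∂ k) p hy
  have hd := (contDiffWithinAt_inChart hΦ.smooth p hy).differentiableWithinAt (by simp)
  have h := pderiv_inner j hr hd hd
  have h1 : (fun z : Euc k => inner ℝ (inChart p Φ z) (inChart p Φ z)) = fun _ => (1 : ℝ) := by
    funext z
    rw [real_inner_self_eq_norm_sq, inChart, Function.comp_apply, (hΦ.mapsTo _).1, one_pow]
  rw [h1, real_inner_comm (inChart p Φ y) (pderiv j (inChart p Φ) y)] at h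
  simp only [pderiv, fderivWithin_const_apply, _root_.zero_apply] at h
  unfold pderiv
  linarith

theorem inner_self_pderiv_pderiv (hΦ : IsIsometricImmersion g r Φ) (p : M) (i j : Fin k) :
    inner ℝ (Φ p) (pderiv i (pderiv j (inChart p Φ)) (extChartAt (𝓡∂ k) p p))
      = -gram g p (extChartAt (𝓡∂ k) p p) i j := by
  have hx := mem_extChartAt_target (I := 𝓡∂ k) p
  have hr := extChartAt_target_subset_range (I := 𝓡∂ k) p hx
  have hs := contDiffWithinAt_inChart hΦ.smooth p hx
  have h := pderiv_inner i hr (hs.differentiableWithinAt (by simp))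
    ((contDiffWithinAt_pderiv j hr hs).differentiableWithinAt (by simp))
  rw [pderiv_congr_of_eventuallyEq (v := fun _ => (0 : ℝ)) _ hr, inChart_self,
    ← gram_apply hΦ p i j hx] at h
  · have h0 : pderiv i (fun _ => (0 : ℝ)) (extChartAt (𝓡∂ k) p p) = 0 := by simp [pderiv]
    linarith
  · filter_upwards [extChartAt_target_mem_nhdsWithin (I := 𝓡∂ k) p] with y hy
    exact inner_inChart_pderiv hΦ p j hy

omit [IsManifold (𝓡∂ k) ∞ M] in
theorem differential_eq_sum (hΦ : ContMDiff (𝓡∂ k) 𝓘(ℝ, Euc (n + 1)) ∞ Φ) (p : M)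
    (v : TangentSpace (𝓡∂ k) p) :
    differential Φ p v = ∑ i, @WithLp.ofLp 2 (Fin k → ℝ) v i •
      pderiv i (inChart p Φ) (extChartAt (𝓡∂ k) p p) := by
  rw [← fderivWithin_eq_sum_pderiv _ _ v]
  exact mfderiv_eq_fderivWithin_inChart (hΦ.mdifferentiableAt (by simp)) v

omit [IsManifold (𝓡∂ k) ∞ M] in
theorem pderiv_mem_range_differential (hΦ : ContMDiff (𝓡∂ k) 𝓘(ℝ, Euc (n + 1)) ∞ Φ) (p : M)
    (i : Fin k) :
    pderiv i (inChart p Φ) (extChartAt (𝓡∂ k) p p)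
      ∈ LinearMap.range (differential (k := k) Φ p).toLinearMap :=
  ⟨(EuclideanSpace.single i (1 : ℝ) : Euc k),
    mfderiv_eq_fderivWithin_inChart (hΦ.mdifferentiableAt (by simp)) _⟩

theorem inner_self_differential (hΦ : IsIsometricImmersion g r Φ) (p : M)
    (v : TangentSpace (𝓡∂ k) p) : inner ℝ (Φ p) (differential Φ p v) = 0 := by
  have h : ∀ i, _ := fun i => inner_inChart_pderiv hΦ p i (mem_extChartAt_target (I := 𝓡∂ k) p)
  simp only [inChart_self] at h
  simp only [differential_eq_sum hΦ.smooth, inner_sum, real_inner_smul_right, h, mul_zero,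
    Finset.sum_const_zero]

theorem secondFundamentalForm_eq (hΦ : IsIsometricImmersion g r Φ) (p : M) (i j : Fin k) :
    secondFundamentalForm Φ p i j
      = vectorHessian g Φ p i j + gram g p (extChartAt (𝓡∂ k) p p) i j • Φ p := by
  set W := pderiv i (pderiv j (inChart p Φ)) (extChartAt (𝓡∂ k) p p) with hW
  set T := ∑ l, christoffel g p l i j (extChartAt (𝓡∂ k) p p) •
      pderiv l (inChart p Φ) (extChartAt (𝓡∂ k) p p) with hT
  have hTr : T ∈ LinearMap.range (differential (k := k) Φ p).toLinearMap :=
    Submodule.sum_mem _ fun l _ =>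
      Submodule.smul_mem _ _ (pderiv_mem_range_differential hΦ.smooth p l)
  have hN : vectorHessian g Φ p i j = W - T := rfl
  have hΦ1 : inner ℝ (Φ p) (Φ p) = 1 := by
    rw [real_inner_self_eq_norm_sq, (hΦ.mapsTo p).1, one_pow]
  have hWΦ := inner_self_pderiv_pderiv hΦ p i j
  have hTΦ : inner ℝ (Φ p) T = 0 := by
    obtain ⟨v, hv⟩ := hTr
    rw [← hv]
    exact inner_self_differential hΦ p v
  -- Projecting to `T𝕊ⁿ` removes the radial part `-g_ij Φ`; the second projection then removes the
  -- tangential part `T`.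
  have h1 : (sphereTangent (Φ p)).starProjection W
      = W + gram g p (extChartAt (𝓡∂ k) p p) i j • Φ p := by
    refine Submodule.eq_starProjection_of_mem_orthogonal ?_ ?_
    · rw [sphereTangent, Submodule.mem_orthogonal_singleton_iff_inner_right, inner_add_right,
        real_inner_smul_right, hΦ1, hWΦ]
      ring
    · rw [sub_add_cancel_left]
      exact Submodule.neg_mem _ (Submodule.smul_mem _ _ (Submodule.le_orthogonal_orthogonal _
        (Submodule.mem_span_singleton_self _)))
  rw [secondFundamentalForm, h1, hN]
  refine Submodule.eq_starProjection_of_mem_orthogonal (Submodule.mem_inf.2 ⟨?_, ?_⟩) ?_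
  · rw [sphereTangent, Submodule.mem_orthogonal_singleton_iff_inner_right, inner_add_right,
      inner_sub_right, real_inner_smul_right, hΦ1, hWΦ, hTΦ]
    ring
  · rw [Submodule.mem_orthogonal]
    rintro _ ⟨v, rfl⟩
    change inner ℝ (differential Φ p v) _ = 0
    rw [inner_add_right, real_inner_smul_right, real_inner_comm (Φ p), inner_self_differential hΦ,
      ← hN, differential_eq_sum hΦ.smooth, sum_inner]
    simp only [real_inner_smul_left, inner_vectorHessian_pderiv hΦ, mul_zero,
      Finset.sum_const_zero, add_zero]
  · rw [Submodule.mem_orthogonal]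
    intro w hw
    have : W + gram g p (extChartAt (𝓡∂ k) p p) i j • Φ p
      - (W - T + gram g p (extChartAt (𝓡∂ k) p p) i j • Φ p) = T := by abel
    rw [this, real_inner_comm]
    exact hw.2 _ hTr

theorem sum_gramInv_mul_gram (hΦ : IsIsometricImmersion g r Φ) (p : M) :
    ∑ i, ∑ j, gramInv g p (extChartAt (𝓡∂ k) p p) i j * gram g p (extChartAt (𝓡∂ k) p p) i j
      = k := by
  have hdet : IsUnit (gram g p (extChartAt (𝓡∂ k) p p)).det :=
    (Matrix.isUnit_iff_isUnit_det _).1 (posDef_gram hΦ p).isUnit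
  have h : ((gramInv g p (extChartAt (𝓡∂ k) p p)) * gram g p (extChartAt (𝓡∂ k) p p)).trace
      = k := by
    rw [gramInv, Matrix.nonsing_inv_mul _ hdet, Matrix.trace_one, Fintype.card_fin]
  rw [← h]
  simp only [Matrix.trace, Matrix.diag, Matrix.mul_apply]
  refine Finset.sum_congr rfl fun i _ => Finset.sum_congr rfl fun j _ => ?_
  -- The trace of the product pairs `g^ij` with `g_ji`; symmetry swaps the indices.
  rw [← (posDef_gram hΦ p).isHermitian.apply j i, star_trivial]

theorem meanCurvature_coordinate (hΦ : IsIsometricImmersion g r Φ) (p : M) (a : Fin (n + 1)) :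
    meanCurvature g Φ p a = laplacian g (fun q => Φ q a) p + (k : ℝ) * Φ p a := by
  simp only [meanCurvature, laplacian, secondFundamentalForm_eq hΦ, hessian_coordinate hΦ.smooth,
    ← sum_gramInv_mul_gram hΦ p, Finset.sum_mul, ← Finset.sum_add_distrib, WithLp.ofLp_sum,
    Finset.sum_apply]
  refine Finset.sum_congr rfl fun i _ => Finset.sum_congr rfl fun j _ => ?_
  simp
  ring

end Hessian

/-! ### The sign of the conormal on the boundary. -/

section Boundary

variable {k : ℕ} [NeZero k] {M : Type*} [TopologicalSpace M]
  [ChartedSpace (EuclideanHalfSpace k) M] [IsManifold (𝓡∂ k) ∞ M]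
  {n : ℕ} {g : RiemMetric k M} {r : ℝ} {Φ : M → Euc (n + 1)}

omit [IsManifold (𝓡∂ k) ∞ M] in
theorem dirDeriv_coordinate (hΦ : ContMDiff (𝓡∂ k) 𝓘(ℝ, Euc (n + 1)) ∞ Φ) (p : M)
    (v : TangentSpace (𝓡∂ k) p) (a : Fin (n + 1)) :
    dirDeriv (fun q => Φ q a) p v = differential Φ p v a := by
  have h := (EuclideanSpace.proj a : Euc (n + 1) →L[ℝ] ℝ).hasMFDerivAt.comp p
    (hΦ.mdifferentiableAt (by simp) (x := p)).hasMFDerivAt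
  exact congrArg (fun L : TangentSpace (𝓡∂ k) p →L[ℝ] ℝ => L v) h.mfderiv

/-- The derivative at a boundary point, in an inward direction, of a function that has a global
minimum there is nonnegative. -/
theorem dirDeriv_nonneg_of_forall_le {f : M → ℝ} {p : M}
    (hf : MDifferentiableAt (𝓡∂ k) 𝓘(ℝ, ℝ) f p) (hmin : ∀ q, f p ≤ f q)
    {v : TangentSpace (𝓡∂ k) p} (hv : 0 ≤ inwardPart p v) : 0 ≤ dirDeriv f p v := by
  have hr := extChartAt_target_subset_range (I := 𝓡∂ k) p (mem_extChartAt_target p)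
  have h1 : dirDeriv f p v = fderivWithin ℝ (inChart p f) (range (𝓡∂ k))
      (extChartAt (𝓡∂ k) p p) v := mfderiv_eq_fderivWithin_inChart hf v
  rw [inwardPart_eq] at hv
  have hloc : IsLocalMinOn (inChart p f) (range (𝓡∂ k)) (extChartAt (𝓡∂ k) p p) :=
    -- The inverse chart is a total function into `M`, so a global minimum on `M` bounds its values
    -- even outside the chart's target.
    Eventually.of_forall fun y => by rw [inChart_self]; exact hmin _
  rw [h1]
  -- The half space is convex and stable under adding an inward vector, so the segment in the
  -- direction `v` stays in it.
  refine hloc.fderivWithin_nonneg (mem_posTangentConeAt_of_segment_subset ?_)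
  refine (𝓡∂ k).convex_range.segment_subset hr ?_
  rw [range_modelWithCornersEuclideanHalfSpace] at hr ⊢
  exact add_nonneg hr hv

/-- `φ₀` is minimal at `p`, so it cannot decrease to first order in the inward direction `-ν`. -/
theorem differential_outwardUnitNormal_zero_nonpos (hΦ : IsIsometricImmersion g r Φ) {p : M}
    (hp : Φ p ∈ capSphere n r) : differential Φ p (outwardUnitNormal g p) 0 ≤ 0 := by
  have hd : MDifferentiableAt (𝓡∂ k) 𝓘(ℝ, ℝ) (fun q => Φ q 0) p :=
    (EuclideanSpace.proj (0 : Fin (n + 1)) : Euc (n + 1) →L[ℝ] ℝ).mdifferentiableAt.comp p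
      (hΦ.smooth.mdifferentiableAt (by simp))
  have h := dirDeriv_nonneg_of_forall_le hd (fun q => hp.2.trans_le (hΦ.mapsTo q).2)
    (v := -outwardUnitNormal g p) (by
      rw [map_neg]
      exact neg_nonneg.2 (isOutwardUnitNormal_outwardUnitNormal g p).outward.le)
  rw [dirDeriv_coordinate hΦ.smooth, map_neg] at h
  exact neg_nonneg.1 h

end Boundary

/-! ### Linear algebra at a boundary point of the geodesic ball. -/

section Cap

variable {n : ℕ}

theorem mem_capSphereTangent {x w : Euc (n + 1)} :
    w ∈ capSphereTangent x ↔ inner ℝ x w = 0 ∧ w 0 = 0 := by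
  simp [capSphereTangent, sphereTangent, Submodule.mem_orthogonal_singleton_iff_inner_right,
    EuclideanSpace.inner_single_left]

/-- The vectors orthogonal to `T_x ∂𝔹ⁿ(r)` are the combinations of `x` and the centre of the ball. -/
theorem exists_eq_of_forall_capSphereTangent {x N : Euc (n + 1)}
    (h : ∀ w ∈ capSphereTangent x, inner ℝ N w = 0) :
    ∃ a b : ℝ, N = a • x + b • EuclideanSpace.single 0 (1 : ℝ) := by
  have h1 : capSphereTangent x
      = (Submodule.span ℝ {x, EuclideanSpace.single 0 (1 : ℝ)})ᗮ := by
    rw [Submodule.span_insert, ← Submodule.inf_orthogonal]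
    rfl
  have h2 : N ∈ (capSphereTangent x)ᗮ :=
    (Submodule.mem_orthogonal' _ _).2 h
  rw [h1, Submodule.orthogonal_orthogonal, Submodule.mem_span_pair] at h2
  obtain ⟨a, b, hab⟩ := h2
  exact ⟨a, b, hab.symm⟩

/-- A unit vector `N` tangent to `𝕊ⁿ` at a point of `∂𝔹ⁿ(r)` that does not point into the ball is
orthogonal to `∂𝔹ⁿ(r)` if and only if it is the outward unit normal of `𝔹ⁿ(r)`. -/
theorem forall_capSphereTangent_iff {r : ℝ} (hr₀ : 0 < r) (hr : r < Real.pi / 2)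
    {x N : Euc (n + 1)} (hx : x ∈ capSphere n r) (hN : inner ℝ N N = 1) (hxN : inner ℝ x N = 0)
    (hN0 : N 0 ≤ 0) :
    (∀ w ∈ capSphereTangent x, inner ℝ N w = 0) ↔
      N 0 + Real.tan r * x 0 = 0 ∧ ∀ i : Fin (n + 1), i ≠ 0 → N i - Real.cot r * x i = 0 := by
  have hs : 0 < Real.sin r := Real.sin_pos_of_pos_of_lt_pi hr₀ (by linarith [Real.pi_pos])
  have hc : 0 < Real.cos r := Real.cos_pos_of_mem_Ioo ⟨by linarith, hr⟩
  have hsc := Real.sin_sq_add_cos_sq r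
  obtain ⟨hx1, hx0⟩ := hx
  have hxx : inner ℝ x x = 1 := by rw [real_inner_self_eq_norm_sq, hx1, one_pow]
  rw [Real.tan_eq_sin_div_cos, Real.cot_eq_cos_div_sin, hx0, div_mul_cancel₀ _ hc.ne']
  constructor
  · intro h
    obtain ⟨a, b, rfl⟩ := exists_eq_of_forall_capSphereTangent h
    simp only [inner_add_left, inner_add_right, real_inner_smul_left, real_inner_smul_right, hxx,
      EuclideanSpace.inner_single_left, EuclideanSpace.inner_single_right, hx0] at hN hxN
    simp [hx0] at hN hxN hN0
    -- This is `⟨x, N⟩ = 0`. Then `|N| = 1` gives `(b sin r)² = 1`, and `N₀ = b sin² r ≤ 0` selects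
    -- the root `-1`.
    have ha : a = -(b * Real.cos r) := by linarith
    subst ha
    have hb : (b * Real.sin r) ^ 2 = 1 := by
      linear_combination hN + b ^ 2 * hsc
    have hb0 : b * Real.sin r ≤ 0 := by
      have : b * Real.sin r * Real.sin r ≤ 0 := by
        have e : b * Real.sin r * Real.sin r = -(b * Real.cos r * Real.cos r) + b := by
          linear_combination b * hsc
        linarith
      exact nonpos_of_mul_nonpos_left this hs
    have hb1 : b * Real.sin r = -1 := by nlinarith
    refine ⟨?_, fun i hi => ?_⟩
    · simp [hx0]
      linear_combination (Real.sin r) * hb1 - b * hsc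
    · simp [hi]
      field_simp
      linear_combination (-(Real.cos r) * x i) * hb1
  · rintro ⟨h0, hi⟩ w hw
    rw [mem_capSphereTangent] at hw
    -- `N` and `cot r · x` agree off the zeroth coordinate, where `w` vanishes.
    have hNw : inner ℝ N w = Real.cos r / Real.sin r * inner ℝ x w := by
      simp only [PiLp.inner_apply, Finset.mul_sum]
      refine Finset.sum_congr rfl fun i _ => ?_
      by_cases h : i = 0
      · subst h
        simp [hw.2]
      · simp only [RCLike.inner_apply, conj_trivial]
        linear_combination w i * hi i h
    rw [hNw, hw.1, mul_zero]

end Cap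

end FreeBoundary

end

theorem mainTheorem8 {k n : ℕ} [NeZero k] {M : Type*} [TopologicalSpace M] [T2Space M]
    [CompactSpace M] [ChartedSpace (EuclideanHalfSpace k) M] [IsManifold (𝓡∂ k) ∞ M]
    (g : RiemMetric k M) {r : ℝ} (hr₀ : 0 < r) (hr : r < Real.pi / 2)
    (Φ : M → EuclideanSpace ℝ (Fin (n + 1))) (hΦ : IsIsometricImmersion g r Φ)
    (hbd : ∀ p ∈ (𝓡∂ k).boundary M, Φ p ∈ capSphere n r) :
    (IsMinimal g Φ ∧ IsFreeBoundary g Φ) ↔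
      (∀ i : Fin (n + 1), ∀ p : M,
        laplacian g (fun q => Φ q i) p + (k : ℝ) * Φ p i = 0) ∧
      (∀ p ∈ (𝓡∂ k).boundary M,
        dirDeriv (fun q => Φ q 0) p (outwardUnitNormal g p) + Real.tan r * Φ p 0 = 0) ∧
      (∀ i : Fin (n + 1), i ≠ 0 → ∀ p ∈ (𝓡∂ k).boundary M,
        dirDeriv (fun q => Φ q i) p (outwardUnitNormal g p) - Real.cot r * Φ p i = 0) := by
  have hmin : IsMinimal g Φ ↔ ∀ i : Fin (n + 1), ∀ p : M,
      laplacian g (fun q => Φ q i) p + (k : ℝ) * Φ p i = 0 := by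
    simp only [← meanCurvature_coordinate hΦ]
    exact ⟨fun h i p => by rw [h p]; rfl, fun h p => PiLp.ext fun i => h i p⟩
  have hfree : ∀ p ∈ (𝓡∂ k).boundary M, _ := fun p hp =>
    forall_capSphereTangent_iff hr₀ hr (hbd p hp)
      ((hΦ.isometric p _ _).trans (isOutwardUnitNormal_outwardUnitNormal g p).unit)
      (inner_self_differential hΦ p (outwardUnitNormal g p))
      (differential_outwardUnitNormal_zero_nonpos hΦ (hbd p hp))
  simp only [dirDeriv_coordinate hΦ.smooth]
  rw [hmin]
  refine and_congr_right fun _ => ⟨fun h => ⟨fun p hp => ((hfree p hp).1 (h p hp)).1,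
    fun i hi p hp => ((hfree p hp).1 (h p hp)).2 i hi⟩, fun h p hp => ?_⟩
  exact (hfree p hp).2 ⟨h.1 p hp, fun i hi => h.2 i hi p hp⟩
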